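/- **Corollary (scalar continued fraction for diagonal $T$).** Fix $d$ and index words $u=(u(1),\dots,u(n))$ in the letters $\{1,\dots,d\}$ by concatenation, $(i,u)=(i,u(1),\dots,u(n))$. Let $T_i^{(k)}$ ($1\le i\le d$, $k\ge 0$) be real $d^k\times d^k$ matrices and $\mathcal C^{(k)}$ ($k\ge 1$) diagonal non-negative real $d^k\times d^k$ matrices, with rows and columns indexed by words of length $k$; write $\mathcal C_u$ for the diagonal entries of $\mathcal C^{(k)}$, and $\kappa_u=\prod_{j=1}^{n}\mathcal C_{(u(j),\dots,u(n))}$. Assume the commutation relation $K^{(k)}T_i^{(k)}=(T_i^{(k)})^{t}K^{(k)}$, $K^{(k)}=\operatorname{diag}(\kappa_u)_{|u|=k}$. On the algebraic Fock space with basis $(e_u)$ and inner product $\langle e_u,e_v\rangle=\delta_{uv}\kappa_u$ let $X_i=a_i^+ +T_i+a_i^-$, where $a_i^+e_u=e_{(i,u)}$, $T_ie_u=\sum_{|w|=|u|}(T_i^{(|u|)})_{w,u}e_w$, $a_i^-e_{(j,u)}=\delta_{ij}\,\mathcal C_{(j,u)}e_u$, $a_i^-e_\emptyset=0$, and let $\phi_{T,\mathcal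 C}[p]=\langle e_\emptyset,p(X_1,\dots,X_d)e_\emptyset\rangle$ for $p\in\mathbb R\langle x_1,\dots,x_d\rangle$. Suppose that all the matrices $T_i^{(k)}$ are diagonal, with diagonal entries $B^{(i)}_u$. Then the moment generating function $$M^\phi(z_1,\dots,z_d)=1+\sum_i\phi[x_i]z_i+\sum_{i,j}\phi[x_ix_j]z_iz_j+\cdots$$ (a formal power series in non-commuting variables) of $\phi=\phi_{T,\mathcal C}$ has the scalar branched continued fraction expansion $$M^{\phi}=\cfrac{1}{1-\sum_{i_0}B^{(i_0)}_{\emptyset}z_{i_0}-\sum_{j_1}\mathcal C_{j_1}\cfrac{z_{j_1}|z_{j_1}}{1-\sum_{i_1}B^{(i_1)}_{j_1}z_{i_1}-\sum_{j_2}\mathcal C_{j_2j_1}\cfrac{z_{j_2}|z_{j_2}}{1-\sum_{i_2}B^{(i_2)}_{j_2j_1}z_{i_2}-\cdots}}}$$ where $\frac{z_j|z_j}{D}$ means $z_jD^{-1}z_j$. Explicitly: if $F^{(0)}_u=0$ and $$F^{(n+1)}_u=\Bigl(1-\sum_iB^{(i)}_uz_i-\sum_j\mathcal C_{(j,u)}\,z_jF^{(n)}_{(j,u)}z_j\Bigr)^{-1},$$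 then for every $N$, for all sufficiently large $n$, the series $F^{(n)}_\emptyset$ and $M^\phi$ have the same coefficients at all words of length less than $N$. The same expansion holds for every state $\phi$ (unital positive linear functional on $\mathbb R\langle x_1,\dots,x_d\rangle$) that has a monic orthogonal polynomial system $(P_u)$ (that is, $P_u=x_u+{}$lower degree and $\phi[P_u^*P_v]=0$ for $u\ne v$) satisfying the recursion with these coefficients, $$x_iP_u=P_{(i,u)}+\sum_{|w|=|u|}(T_i^{(|u|)})_{w,u}P_w+\delta_{i,u(1)}\,\mathcal C_uP_{(u(2),\dots,u(n))}$$ (for $u=\emptyset$ the last term is absent). -/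

import Mathlib

open Filter

namespace NCOP

/-! ### Formal power series in non-commuting variables -/

/-- The formal power series `ℝ⟨⟨z_1, …, z_d⟩⟩` in `d` non-commuting variables: a series is the
function that assigns to each word `w` the coefficient of `z_w = z_{w(1)} ⋯ z_{w(n)}`. -/
def NCPowerSeries (d : ℕ) : Type := List (Fin d) → ℝ

namespace NCPowerSeries

variable {d : ℕ}

instance : AddCommGroup (NCPowerSeries d) := inferInstanceAs (AddCommGroup (List (Fin d) → ℝ))

instance : Module ℝ (NCPowerSeries d) := inferInstanceAs (Module ℝ (List (Fin d) → ℝ))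

/-- The coefficient of `z_w`. -/
def coeff (w : List (Fin d)) (f : NCPowerSeries d) : ℝ := f w

@[ext] theorem ext {f g : NCPowerSeries d} (h : ∀ w, coeff w f = coeff w g) : f = g := funext h

/-- The constant series `1`. -/
instance : One (NCPowerSeries d) := ⟨fun w => if w = [] then 1 else 0⟩

/-- The Cauchy product: the coefficient at `w` is the sum over all factorizations of the word `w`
into a prefix and a suffix. -/
instance : Mul (NCPowerSeries d) :=
  ⟨fun f g w => ∑ k ∈ Finset.range (w.length + 1), f (w.take k) * g (w.drop k)⟩

/-- The variable `z_i`. -/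
def z (i : Fin d) : NCPowerSeries d := fun w => if w = [i] then 1 else 0

theorem coeff_one (w : List (Fin d)) :
    coeff w (1 : NCPowerSeries d) = if w = [] then 1 else 0 := rfl

theorem coeff_z (i : Fin d) (w : List (Fin d)) :
    coeff w (z i) = if w = [i] then 1 else 0 := rfl

theorem coeff_mul (w : List (Fin d)) (f g : NCPowerSeries d) :
    coeff w (f * g)
      = ∑ k ∈ Finset.range (w.length + 1), coeff (w.take k) f * coeff (w.drop k) g := rfl

theorem coeff_add (w : List (Fin d)) (f g : NCPowerSeries d) :
    coeff w (f + g) = coeff w f + coeff w g := rfl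

theorem coeff_sub (w : List (Fin d)) (f g : NCPowerSeries d) :
    coeff w (f - g) = coeff w f - coeff w g := rfl

theorem coeff_zero (w : List (Fin d)) : coeff w (0 : NCPowerSeries d) = 0 := rfl

theorem coeff_smul (w : List (Fin d)) (c : ℝ) (f : NCPowerSeries d) :
    coeff w (c • f) = c * coeff w f := rfl

theorem coeff_sum {ι : Type*} (w : List (Fin d)) (s : Finset ι) (f : ι → NCPowerSeries d) :
    coeff w (∑ i ∈ s, f i) = ∑ i ∈ s, coeff w (f i) :=
  Finset.sum_apply w s f

theorem mul_assoc_aux (f g h : NCPowerSeries d) : f * g * h = f * (g * h) := by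
  ext w
  simp only [coeff_mul, Finset.sum_mul, Finset.mul_sum, List.length_take, List.length_drop]
  rw [Finset.sum_sigma', Finset.sum_sigma']
  refine Finset.sum_bij' (fun p _ => ⟨p.2, p.1 - p.2⟩) (fun q _ => ⟨q.1 + q.2, q.1⟩)
    ?_ ?_ ?_ ?_ ?_
  · rintro ⟨i, j⟩ hp
    simp only [Finset.mem_sigma, Finset.mem_range] at hp ⊢
    omega
  · rintro ⟨i, j⟩ hp
    simp only [Finset.mem_sigma, Finset.mem_range] at hp ⊢
    omega
  · rintro ⟨i, j⟩ hp
    simp only [Finset.mem_sigma, Finset.mem_range] at hp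
    simp only [Sigma.mk.injEq, heq_eq_eq, and_true]
    omega
  · rintro ⟨i, j⟩ hp
    simp
  · rintro ⟨i, j⟩ hp
    simp only [Finset.mem_sigma, Finset.mem_range] at hp
    have h1 : j ≤ i := by omega
    simp only [List.take_take, List.drop_take, List.drop_drop, min_eq_left h1,
      Nat.add_sub_cancel' h1, mul_assoc]

instance : Ring (NCPowerSeries d) :=
  { (inferInstance : AddCommGroup (NCPowerSeries d)) with
    mul_assoc := mul_assoc_aux
    one_mul := by
      intro f
      ext w
      rw [coeff_mul, Finset.sum_eq_single 0]
      · simp [coeff_one]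
      · intro k hk hk0
        have : w.take k ≠ [] := by
          intro h
          rw [List.take_eq_nil_iff] at h
          rcases h with h | h
          · exact hk0 h
          · subst h; simp at hk; exact hk0 hk
        simp [coeff_one, this]
      · simp
    mul_one := by
      intro f
      ext w
      rw [coeff_mul, Finset.sum_eq_single w.length]
      · simp [coeff_one]
      · intro k hk hk0
        have : w.drop k ≠ [] := by
          intro h
          rw [List.drop_eq_nil_iff] at h
          simp at hk
          omega
        simp [coeff_one, this]
      · simp
    left_distrib := by
      intro f g h
      ext w
      simp only [coeff_mul, coeff_add, mul_add, Finset.sum_add_distrib]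
    right_distrib := by
      intro f g h
      ext w
      simp only [coeff_mul, coeff_add, add_mul, Finset.sum_add_distrib]
    zero_mul := by
      intro f
      ext w
      simp [coeff_mul, coeff_zero]
    mul_zero := by
      intro f
      ext w
      simp [coeff_mul, coeff_zero] }

theorem coeff_pow_eq_zero {a : NCPowerSeries d} (ha : coeff [] a = 0) (n : ℕ) :
    ∀ w : List (Fin d), w.length < n → coeff w (a ^ n) = 0 := by
  induction n with
  | zero => intro w hw; omega
  | succ n ih =>
    intro w hw
    rw [pow_succ', coeff_mul]
    refine Finset.sum_eq_zero fun k hk => ?_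
    rcases Nat.eq_zero_or_pos k with rfl | hk0
    · simp [ha]
    · by_cases h : (w.drop k).length < n
      · rw [ih _ h, mul_zero]
      · rw [List.length_drop] at h
        have : w = [] := List.eq_nil_of_length_eq_zero (by omega)
        subst this
        simp [ha]

/-- A series with constant coefficient `1` is invertible, so that `Ring.inverse` of it is its
genuine two-sided inverse. -/
theorem isUnit_of_coeff_nil_eq_one {f : NCPowerSeries d} (hf : coeff [] f = 1) : IsUnit f := by
  have key : ∀ g : NCPowerSeries d, coeff [] g = 1 →
      ∃ h : NCPowerSeries d, g * h = 1 ∧ coeff [] h = 1 := by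
    intro g hg
    obtain ⟨a, rfl⟩ : ∃ a, g = 1 - a := ⟨1 - g, by abel⟩
    have ha : coeff [] a = 0 := by
      rw [coeff_sub, coeff_one] at hg
      simpa using hg
    have hS : ∀ N, ∀ w : List (Fin d), w.length < N →
        coeff w (∑ n ∈ Finset.range N, a ^ n)
          = coeff w (∑ n ∈ Finset.range (w.length + 1), a ^ n) := by
      intro N w hw
      rw [coeff_sum, coeff_sum]
      symm
      refine Finset.sum_subset (fun n hn => ?_) (fun n _ hn => ?_)
      · simp only [Finset.mem_range] at hn ⊢
        omega
      · simp only [Finset.mem_range, not_lt] at hn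
        exact coeff_pow_eq_zero ha n w (by omega)
    let h : NCPowerSeries d := fun w => coeff w (∑ n ∈ Finset.range (w.length + 1), a ^ n)
    refine ⟨h, ?_, ?_⟩
    · ext w
      have e : coeff w ((1 - a) * h)
          = coeff w ((1 - a) * ∑ n ∈ Finset.range (w.length + 1), a ^ n) := by
        rw [coeff_mul, coeff_mul]
        refine Finset.sum_congr rfl fun k _ => ?_
        rw [hS (w.length + 1) (w.drop k) (by rw [List.length_drop]; omega)]
        rfl
      rw [e, mul_neg_geom_sum, coeff_sub, coeff_pow_eq_zero ha _ w (Nat.lt_succ_self _), sub_zero]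
    · change coeff [] (∑ n ∈ Finset.range 1, a ^ n) = 1
      simp [coeff_one]
  obtain ⟨g, hg, hg1⟩ := key f hf
  obtain ⟨h, hh, -⟩ := key g hg1
  have hfh : f = h := by
    calc f = f * (g * h) := by rw [hh, mul_one]
      _ = h := by rw [← mul_assoc, hg, one_mul]
  exact ⟨⟨f, g, hg, by rw [hfh, hh]⟩, rfl⟩

end NCPowerSeries

/-! ### Scalar branched continued fractions -/

section ContinuedFraction

variable {d : ℕ}

open NCPowerSeries

/-- The approximant of depth `n` of the part, sitting at the word `u`, of the scalar branched
continued fraction with coefficients `B^{(i)}_u` and `C_u`: the approximant of depth `0` is `0`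
and
`F_u^{(n+1)} = 1 / (1 - ∑_i B^{(i)}_u z_i - ∑_j C_{(j,u)} (z_j | z_j) / (denominator at (j,u)))`,
where `(z_j | z_j) / D` stands for `z_j D⁻¹ z_j`. All denominators have constant coefficient `1`,
hence are invertible (`isUnit_cfDenom`). -/
noncomputable def cfApprox (B : Fin d → List (Fin d) → ℝ) (C : List (Fin d) → ℝ) :
    ℕ → List (Fin d) → NCPowerSeries d
  | 0, _ => 0
  | n + 1, u => Ring.inverse
      (1 - ∑ i, B i u • z i - ∑ j, C (j :: u) • (z j * cfApprox B C n (j :: u) * z j))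

theorem isUnit_cfDenom (B : Fin d → List (Fin d) → ℝ) (C : List (Fin d) → ℝ) (n : ℕ)
    (u : List (Fin d)) :
    IsUnit (1 - ∑ i, B i u • z i - ∑ j, C (j :: u) • (z j * cfApprox B C n (j :: u) * z j)) := by
  apply isUnit_of_coeff_nil_eq_one
  simp [coeff_sub, coeff_sum, coeff_smul, coeff_mul, coeff_z, coeff_one]

/-- The series `M` equals the infinite branched continued fraction
`1 / (1 - ∑_i B^{(i)}_∅ z_i - ∑_{j₁} C_{j₁} (z_{j₁} | z_{j₁}) / (1 - ∑_i B^{(i)}_{j₁} z_i - ⋯))`: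
its approximants converge to `M` formally, that is, for every `N` all approximants of sufficiently
large depth have the same coefficients as `M` at all words of length less than `N`. -/
def HasScalarCF (M : NCPowerSeries d) (B : Fin d → List (Fin d) → ℝ)
    (C : List (Fin d) → ℝ) : Prop :=
  ∀ N : ℕ, ∀ᶠ n in atTop, ∀ w : List (Fin d), w.length < N →
    coeff w (cfApprox B C n []) = coeff w M

end ContinuedFraction

/-! ### States on non-commutative polynomials and monic orthogonal polynomials -/

section States

variable {d : ℕ}

/-- The monomial `x_u = x_{u(1)} ⋯ x_{u(n)}` in `ℝ⟨x_1, …, x_d⟩`. -/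
noncomputable def monomial (u : List (Fin d)) : FreeAlgebra ℝ (Fin d) :=
  (u.map (FreeAlgebra.ι ℝ)).prod

/-- A state on `ℝ⟨x_1, …, x_d⟩`: a positive linear functional that takes the identity to `1`.
Here `star` is the involution fixing all `x_i` and reversing words. -/
structure IsState (φ : FreeAlgebra ℝ (Fin d) →ₗ[ℝ] ℝ) : Prop where
  map_one : φ 1 = 1
  nonneg : ∀ p, 0 ≤ φ (star p * p)

/-- A monic orthogonal polynomial system (MOPS) for `φ`: a family `P_u = x_u + (lower degree)`
indexed by all words, such that `φ[P_u^* P_v] = 0` for `u ≠ v`. -/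
structure IsMOPS (φ : FreeAlgebra ℝ (Fin d) →ₗ[ℝ] ℝ)
    (P : List (Fin d) → FreeAlgebra ℝ (Fin d)) : Prop where
  monic : ∀ u, P u - monomial u ∈ Submodule.span ℝ {p | ∃ v, v.length < u.length ∧ p = monomial v}
  orthogonal : ∀ u v, u ≠ v → φ (star (P u) * P v) = 0

/-- The moment generating function
`M^φ(z_1, …, z_d) = 1 + ∑_i φ[x_i] z_i + ∑_{i,j} φ[x_i x_j] z_i z_j + ⋯`. -/
noncomputable def momentSeries (φ : FreeAlgebra ℝ (Fin d) →ₗ[ℝ] ℝ) : NCPowerSeries d :=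
  fun w => φ (monomial w)

/-- Words of length `k` in `d` letters; there are `d ^ k` of them. -/
abbrev Word (d k : ℕ) : Type := List.Vector (Fin d) k

/-- The weight `∏_j C_{(u(j), …, u(n))}` of the word `u`, over all its nonempty postfixes; this is
the squared norm of the basis vector `e_u` of the Fock space. -/
def weight (C : (k : ℕ) → Matrix (Word d k) (Word d k) ℝ) : List (Fin d) → ℝ
  | [] => 1
  | i :: u => C (u.length + 1) ⟨i :: u, rfl⟩ ⟨i :: u, rfl⟩ * weight C u

/-- The matrices that parametrize the states with MOPS: `d^k × d^k` matrices `T_i^{(k)}`,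
`k ≥ 0`, and diagonal non-negative `d^k × d^k` matrices `C^{(k)}`, `k ≥ 1` (the value at `k = 0`
is never used), with the commutation relation which says that `T_i` is symmetric for the inner
product of the Fock space. -/
structure JacobiData (d : ℕ) where
  T : (k : ℕ) → Fin d → Matrix (Word d k) (Word d k) ℝ
  C : (k : ℕ) → Matrix (Word d k) (Word d k) ℝ
  C_diag : ∀ k, 1 ≤ k → (C k).IsDiag
  C_nonneg : ∀ k, 1 ≤ k → ∀ u, 0 ≤ C k u u
  comm : ∀ k i, Matrix.diagonal (fun u : Word d k => weight C u.1) * T k i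
    = (T k i).transpose * Matrix.diagonal (fun u : Word d k => weight C u.1)

namespace JacobiData

variable (J : JacobiData d)

/-- The diagonal entry `B^{(i)}_u` of `T_i^{(k)}`, where `k` is the length of `u`. -/
def diagT (i : Fin d) (u : List (Fin d)) : ℝ := J.T u.length i ⟨u, rfl⟩ ⟨u, rfl⟩

/-- The diagonal entry `C_u` of `C^{(k)}`, where `k` is the length of `u`. -/
def diagC (u : List (Fin d)) : ℝ := J.C u.length ⟨u, rfl⟩ ⟨u, rfl⟩

/-- The inner product of the (algebraic) Fock space: the vectors `e_u` are orthogonal and the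
squared norm of `e_u` is the weight of `u`. -/
noncomputable def fockInner (f g : List (Fin d) →₀ ℝ) : ℝ :=
  f.sum fun u a => a * g u * weight J.C u

/-- The creation operator `e_u ↦ e_{(i,u)}`. -/
noncomputable def creation (i : Fin d) : (List (Fin d) →₀ ℝ) →ₗ[ℝ] (List (Fin d) →₀ ℝ) :=
  Finsupp.lmapDomain ℝ ℝ (List.cons i)

/-- The operator that acts by `T_i^{(k)}` on the span of the `e_u` with `u` of length `k`. -/
noncomputable def preservation (i : Fin d) : (List (Fin d) →₀ ℝ) →ₗ[ℝ] (List (Fin d) →₀ ℝ) :=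
  Finsupp.linearCombination ℝ fun u =>
    ∑ w : Word d u.length, J.T u.length i w ⟨u, rfl⟩ • Finsupp.single w.1 (1 : ℝ)

/-- The annihilation operator `e_{(j,u)} ↦ δ_{ij} C_{(j,u)} e_u`, `e_∅ ↦ 0`. -/
noncomputable def annihilation (i : Fin d) : (List (Fin d) →₀ ℝ) →ₗ[ℝ] (List (Fin d) →₀ ℝ) :=
  Finsupp.linearCombination ℝ fun u =>
    match u with
    | [] => 0
    | j :: v => if j = i then J.diagC (j :: v) • Finsupp.single v (1 : ℝ) else 0

/-- The Fock space representation `x_i ↦ X_i = a_i^+ + T_i + a_i^-` of `ℝ⟨x_1, …, x_d⟩`. -/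
noncomputable def rep :
    FreeAlgebra ℝ (Fin d) →ₐ[ℝ] Module.End ℝ (List (Fin d) →₀ ℝ) :=
  FreeAlgebra.lift ℝ fun i => creation i + J.preservation i + J.annihilation i

/-- The state `φ_{T,C}[p] = ⟨e_∅, p(X_1, …, X_d) e_∅⟩`. -/
noncomputable def state : FreeAlgebra ℝ (Fin d) →ₗ[ℝ] ℝ where
  toFun p := J.fockInner (Finsupp.single [] 1) (J.rep p (Finsupp.single [] 1))
  map_add' p q := by simp [fockInner, Finsupp.sum_single_index, weight]
  map_smul' c p := by simp [fockInner, Finsupp.sum_single_index, weight]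

/-- The family `P` satisfies the recursion relation
`x_i P_u = P_{(i,u)} + ∑_{|w| = |u|} (T_i)_{w,u} P_w + δ_{i,u(1)} C_u P_{(u(2), …, u(n))}`. -/
def IsRecursion (P : List (Fin d) → FreeAlgebra ℝ (Fin d)) : Prop :=
  ∀ (i : Fin d) (u : List (Fin d)),
    FreeAlgebra.ι ℝ i * P u = P (i :: u)
      + ∑ w : Word d u.length, J.T u.length i w ⟨u, rfl⟩ • P w.1
      + (match u with
        | [] => 0
        | j :: v => if j = i then J.diagC (j :: v) • P v else 0)

end JacobiData

end States

end NCOP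

namespace NCOP

open NCPowerSeries

variable {d : ℕ}

/-! ### Congruence of series up to a given word length -/

namespace NCPowerSeries

/-! For each word `v` let `A_v` be the generating series, over words `w`, of the coefficient of `X_w
e_∅` at `e_v`; then `A_∅` is the moment series. Splitting off the first letter of `w` gives, for
diagonal `T_i`, the system `A_v = I_v + ∑ B_v^{(i)} z_i A_v + ∑ C_{(i,v)} z_i A_{(i,v)}` with `I_∅ =
1` and `I_{(j,t)} = z_j A_t` (`fockSeries_eq`). The approximants eliminate this system from the
bottom up: if `A_{(i,v)}` agrees with `F_{(i,v)} z_i A_v` below order `n`, substitution turns the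
equation at `v` into `D_v A_v = I_v` below order `n + 1`, and `D_v` is invertible
(`agreeBelow_cfApprox_mul`). At `v = ∅` this says that the approximant of depth `n` agrees with the
moment series below order `n`. A state with a MOPS obeying the recursion has the same moments as the
Fock state: `e_u ↦ P_u` intertwines `X_i` with multiplication by `x_i`, and orthogonality to `P_∅ =
1` makes `φ` read off the coefficient at `e_∅`. -/

theorem coeff_nil_z_mul (i : Fin d) (f : NCPowerSeries d) : coeff [] (z i * f) = 0 := by
  simp [coeff_mul, coeff_z]

theorem coeff_cons_z_mul (i j : Fin d) (w : List (Fin d)) (f : NCPowerSeries d) :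
    coeff (j :: w) (z i * f) = if j = i then coeff w f else 0 := by
  rw [coeff_mul, Finset.sum_eq_single 1]
  · simp [coeff_z]
  · intro k hk hk1
    have : (j :: w).take k ≠ [i] := by
      intro h
      have := congrArg List.length h
      simp only [List.length_take, List.length_cons, List.length_nil, Finset.mem_range] at this hk
      omega
    rw [coeff_z, if_neg this, zero_mul]
  · simp

/-- Two series agree up to order `N` if they have the same coefficients at all words of length
less than `N`. -/
def AgreeBelow (N : ℕ) (f g : NCPowerSeries d) : Prop :=
  ∀ w : List (Fin d), w.length < N → coeff w f = coeff w g

namespace AgreeBelow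

variable {N : ℕ} {f g : NCPowerSeries d}

theorem mul_left (h : AgreeBelow N f g) (p : NCPowerSeries d) :
    AgreeBelow N (p * f) (p * g) := by
  intro w hw
  rw [coeff_mul, coeff_mul]
  refine Finset.sum_congr rfl fun k _ => ?_
  rw [h _ (by rw [List.length_drop]; omega)]

/-- The extra variable shifts all coefficients by one letter, so one order is gained; this gain
drives the convergence. -/
theorem z_mul (h : AgreeBelow N f g) (i : Fin d) :
    AgreeBelow (N + 1) (z i * f) (z i * g) := by
  rintro (_ | ⟨j, w⟩) hw
  · rw [coeff_nil_z_mul, coeff_nil_z_mul]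
  · rw [coeff_cons_z_mul, coeff_cons_z_mul, h w (by simpa using hw)]

end AgreeBelow

theorem smul_mul (c : ℝ) (f g : NCPowerSeries d) : (c • f) * g = c • (f * g) := by
  ext w
  simp only [coeff_mul, coeff_smul, Finset.mul_sum, mul_assoc]

end NCPowerSeries

/-! ### The linear system behind a branched continued fraction -/

/-- The inhomogeneous part of the linear system satisfied by a family of series `A`. -/
noncomputable def inhomogeneous (A : List (Fin d) → NCPowerSeries d) :
    List (Fin d) → NCPowerSeries d
  | [] => 1
  | j :: v => z j * A v

/-- The approximants of the continued fraction solve, up to growing order, every tridiagonal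
linear system with the same coefficients. -/
theorem agreeBelow_cfApprox_mul {B : Fin d → List (Fin d) → ℝ} {C : List (Fin d) → ℝ}
    {A : List (Fin d) → NCPowerSeries d}
    (hA : ∀ v, A v = inhomogeneous A v + ∑ i, B i v • (z i * A v)
      + ∑ i, C (i :: v) • (z i * A (i :: v))) (n : ℕ) :
    ∀ v, AgreeBelow n (cfApprox B C n v * inhomogeneous A v) (A v) := by
  induction n with
  | zero => intro v w hw; omega
  | succ n ih =>
    intro v
    set D := 1 - ∑ i, B i v • z i - ∑ j, C (j :: v) • (z j * cfApprox B C n (j :: v) * z j)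
      with hD
    have hunit : IsUnit D := isUnit_cfDenom B C n v
    have hF : cfApprox B C (n + 1) v = Ring.inverse D := rfl
    have hDA : AgreeBelow (n + 1) (inhomogeneous A v) (D * A v) := by
      intro w hw
      have hI : inhomogeneous A v = A v - ∑ i, B i v • (z i * A v)
          - ∑ i, C (i :: v) • (z i * A (i :: v)) := by
        rw [eq_sub_iff_add_eq, eq_sub_iff_add_eq]
        exact (add_right_comm _ _ _).trans (hA v).symm
      rw [hI, hD, sub_mul, sub_mul, one_mul, Finset.sum_mul, Finset.sum_mul]
      simp only [smul_mul, mul_assoc]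
      rw [coeff_sub, coeff_sub, coeff_sub, coeff_sub]
      congr 1
      rw [coeff_sum, coeff_sum]
      refine Finset.sum_congr rfl fun i _ => ?_
      -- `A_{(i,v)}` is replaced by `F_{(i,v)} I_{(i,v)}`, and `I_{(i,v)}` is `z_i A_v` by
      -- definition: this produces the second `z_i` of the fraction.
      rw [coeff_smul, coeff_smul, (ih (i :: v)).z_mul i w hw |>.symm]
      rfl
    have h := hDA.mul_left (Ring.inverse D)
    rwa [← mul_assoc, Ring.inverse_mul_cancel D hunit, one_mul, ← hF] at h

/-! ### Moments in the Fock space representation -/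

theorem monomial_cons (i : Fin d) (w : List (Fin d)) :
    monomial (i :: w) = FreeAlgebra.ι ℝ i * monomial w := by
  simp [monomial]

namespace JacobiData

variable (J : JacobiData d)

theorem sum_T_smul_of_isDiag {E : Type*} [AddCommMonoid E] [Module ℝ E]
    (hT : ∀ k i, (J.T k i).IsDiag) (i : Fin d) (u : List (Fin d)) (f : List (Fin d) → E) :
    ∑ w : Word d u.length, J.T u.length i w ⟨u, rfl⟩ • f w.1 = J.diagT i u • f u := by
  rw [Finset.sum_eq_single ⟨u, rfl⟩]
  · rfl
  · intro w _ hw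
    rw [hT u.length i hw, zero_smul]
  · exact fun h => absurd (Finset.mem_univ _) h

theorem rep_ι (i : Fin d) :
    J.rep (FreeAlgebra.ι ℝ i) = creation i + J.preservation i + J.annihilation i := by
  simp [rep]

/-- The action of `X_i` read on coordinates: `e_v` is reached from its tail by creation, from itself
by the diagonal `T_i`, and from `e_{(i,v)}` by annihilation. -/
theorem rep_ι_apply (hT : ∀ k i, (J.T k i).IsDiag) (i : Fin d) (f : List (Fin d) →₀ ℝ)
    (v : List (Fin d)) :
    J.rep (FreeAlgebra.ι ℝ i) f v
      = (match v with
          | [] => 0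
          | j :: t => if j = i then f t else 0)
        + J.diagT i v * f v + J.diagC (i :: v) * f (i :: v) := by
  rw [rep_ι]
  induction f using Finsupp.induction_linear with
  | zero => cases v <;> simp
  | add f g hf hg =>
    rw [map_add, Finsupp.add_apply, hf, hg]
    cases v with
    | nil => simp only [Finsupp.add_apply]; ring
    | cons j t =>
      by_cases h : j = i
      · simp only [Finsupp.add_apply, h, if_true]; ring
      · simp only [Finsupp.add_apply, h, if_false]; ring
  | single u a =>
    simp only [LinearMap.add_apply, Finsupp.add_apply]
    congr 1
    · congr 1
      · rw [creation, Finsupp.lmapDomain_apply, Finsupp.mapDomain_single, Finsupp.single_apply]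
        cases v with
        | nil => simp
        | cons j t =>
          simp only [List.cons.injEq, Finsupp.single_apply]
          by_cases h : j = i
          · simp [h]
          · simp [h, Ne.symm h]
      · rw [preservation, Finsupp.linearCombination_single,
          J.sum_T_smul_of_isDiag hT i u (fun w => Finsupp.single w (1 : ℝ))]
        by_cases h : u = v
        · subst h
          simp [mul_comm]
        · simp [h]
    · rw [annihilation, Finsupp.linearCombination_single]
      cases u with
      | nil => simp
      | cons j t =>
        by_cases h : j = i
        · subst h
          by_cases h' : t = v
          · subst h'
            simp [mul_comm]
          · simp [h']
        · simp [h]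

/-- The generating series, over all words `w`, of the coefficients at `e_v` of `X_w e_∅`. -/
noncomputable def fockSeries (v : List (Fin d)) : NCPowerSeries d :=
  fun w => J.rep (monomial w) (Finsupp.single [] 1) v

theorem coeff_fockSeries (v w : List (Fin d)) :
    coeff w (J.fockSeries v) = J.rep (monomial w) (Finsupp.single [] 1) v := rfl

theorem coeff_nil_fockSeries (v : List (Fin d)) :
    coeff [] (J.fockSeries v) = if v = [] then 1 else 0 := by
  simp [coeff_fockSeries, monomial, Finsupp.single_apply, eq_comm]

theorem state_apply (p : FreeAlgebra ℝ (Fin d)) :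
    J.state p = J.rep p (Finsupp.single [] 1) [] := by
  simp [state, fockInner, Finsupp.sum_single_index, weight]

theorem momentSeries_state : momentSeries J.state = J.fockSeries [] := by
  ext w
  exact J.state_apply (monomial w)

theorem fockSeries_eq (hT : ∀ k i, (J.T k i).IsDiag) (v : List (Fin d)) :
    J.fockSeries v = inhomogeneous J.fockSeries v
      + ∑ i, J.diagT i v • (z i * J.fockSeries v)
      + ∑ i, J.diagC (i :: v) • (z i * J.fockSeries (i :: v)) := by
  ext w
  simp only [coeff_add, coeff_sum, coeff_smul]
  cases w with
  | nil =>
    simp only [coeff_nil_z_mul, coeff_nil_fockSeries, mul_zero, Finset.sum_const_zero, add_zero]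
    cases v with
    | nil => simp [inhomogeneous, coeff_one]
    | cons j t => simp [inhomogeneous, coeff_nil_z_mul]
  | cons i w =>
    simp only [coeff_cons_z_mul, mul_ite, mul_zero, Finset.sum_ite_eq, Finset.mem_univ, if_true]
    -- The first letter of the word is the operator applied last, so the coordinate formula for
    -- `X_i` applies to `X_w e_∅`.
    rw [coeff_fockSeries, monomial_cons, map_mul, Module.End.mul_apply, J.rep_ι_apply hT]
    simp only [coeff_fockSeries]
    congr 2
    cases v with
    | nil => simp [inhomogeneous, coeff_one]
    | cons j t => simp [inhomogeneous, coeff_cons_z_mul, coeff_fockSeries, eq_comm]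

theorem hasScalarCF_state (hT : ∀ k i, (J.T k i).IsDiag) :
    HasScalarCF (momentSeries J.state) J.diagT J.diagC := by
  intro N
  filter_upwards [eventually_ge_atTop N] with n hn w hw
  have h := agreeBelow_cfApprox_mul (J.fockSeries_eq hT) n [] w (hw.trans_le hn)
  rwa [inhomogeneous, mul_one, ← momentSeries_state] at h

/-! ### States with orthogonal polynomials -/

variable {J}

/-- The map `e_u ↦ P_u` intertwines `X_i` and the multiplication by `x_i`. -/
theorem IsRecursion.linearCombination_rep_ι {P : List (Fin d) → FreeAlgebra ℝ (Fin d)}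
    (hP : J.IsRecursion P) (i : Fin d) (f : List (Fin d) →₀ ℝ) :
    Finsupp.linearCombination ℝ P (J.rep (FreeAlgebra.ι ℝ i) f)
      = FreeAlgebra.ι ℝ i * Finsupp.linearCombination ℝ P f := by
  induction f using Finsupp.induction_linear with
  | zero => simp
  | add f g hf hg => rw [map_add, map_add, hf, hg, map_add, mul_add]
  | single u a =>
    rw [Finsupp.linearCombination_single, mul_smul_comm, hP i u, rep_ι]
    simp only [LinearMap.add_apply, map_add, smul_add]
    congr 1
    · congr 1
      · simp [creation]
      · simp [preservation, map_sum]
    · rw [annihilation, Finsupp.linearCombination_single, map_smul]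
      cases u with
      | nil => simp
      | cons j t =>
        by_cases h : j = i
        · simp [h]
        · simp [h]

/-- Under `e_u ↦ P_u` the vacuum goes to `1`, so the intertwining relation rebuilds the monomial
letter by letter. -/
theorem IsRecursion.linearCombination_rep_monomial {P : List (Fin d) → FreeAlgebra ℝ (Fin d)}
    (hP : J.IsRecursion P) (h1 : P [] = 1) (w : List (Fin d)) :
    Finsupp.linearCombination ℝ P (J.rep (monomial w) (Finsupp.single [] 1)) = monomial w := by
  induction w with
  | nil => simp [monomial, h1]
  | cons i w ih =>
    rw [monomial_cons, map_mul, Module.End.mul_apply, hP.linearCombination_rep_ι, ih]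

end JacobiData

/-- No word is shorter than the empty one, so the span of lower terms is zero. -/
theorem IsMOPS.apply_nil {φ : FreeAlgebra ℝ (Fin d) →ₗ[ℝ] ℝ}
    {P : List (Fin d) → FreeAlgebra ℝ (Fin d)} (hP : IsMOPS φ P) : P [] = 1 := by
  have h := hP.monic []
  simpa [monomial, sub_eq_zero] using h

theorem momentSeries_eq_of_isRecursion {J : JacobiData d} {φ : FreeAlgebra ℝ (Fin d) →ₗ[ℝ] ℝ}
    {P : List (Fin d) → FreeAlgebra ℝ (Fin d)} (hφ : IsState φ) (hP : IsMOPS φ P)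
    (hR : J.IsRecursion P) : momentSeries φ = momentSeries J.state := by
  have h1 := hP.apply_nil
  -- By orthogonality to `P_∅ = 1`, `φ` kills every `P_u` with `u ≠ ∅`.
  have key : ∀ f : List (Fin d) →₀ ℝ, φ (Finsupp.linearCombination ℝ P f) = f [] := by
    intro f
    induction f using Finsupp.induction_linear with
    | zero => simp
    | add f g hf hg => rw [map_add, map_add, hf, hg, Finsupp.add_apply]
    | single u a =>
      rw [Finsupp.linearCombination_single, map_smul]
      by_cases h : u = []
      · simp [h, h1, hφ.map_one]
      · have := hP.orthogonal [] u (Ne.symm h)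
        rw [h1, star_one, one_mul] at this
        simp [this, h]
  ext w
  change φ (monomial w) = J.state (monomial w)
  rw [J.state_apply, ← key, hR.linearCombination_rep_monomial h1]

end NCOP

theorem mainTheorem4 {d : ℕ} (J : NCOP.JacobiData d) (hT : ∀ k i, (J.T k i).IsDiag) :
    NCOP.HasScalarCF (NCOP.momentSeries J.state) J.diagT J.diagC ∧
    ∀ (φ : FreeAlgebra ℝ (Fin d) →ₗ[ℝ] ℝ) (P : List (Fin d) → FreeAlgebra ℝ (Fin d)),
      NCOP.IsState φ → NCOP.IsMOPS φ P → J.IsRecursion P →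
        NCOP.HasScalarCF (NCOP.momentSeries φ) J.diagT J.diagC := by
  refine ⟨J.hasScalarCF_state hT, fun φ P hφ hP hR => ?_⟩
  rw [NCOP.momentSeries_eq_of_isRecursion hφ hP hR]
  exact J.hasScalarCF_state hT
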